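/- Let $\{1,\dots,n\}=N_1\cup\dots\cup N_j$ be a partition of the coordinates of $\mathbb{R}^n$ into $j$ non-empty blocks, and let $\mathbf{s}=(s_1,\dots,s_j)\in\mathbb{R}^j$. Let $\Delta_l=\sum_{k\in N_l}\partial_k^2$ be the Laplacian in the $l$-th block of variables, and put $\langle\langle D\rangle\rangle^{\mathbf{s}}=(1-\Delta_1)^{s_1/2}\otimes\dots\otimes(1-\Delta_j)^{s_j/2}$, the Fourier multiplier with symbol $\prod_{l=1}^{j}\bigl(1+\sum_{k\in N_l}\xi_k^2\bigr)^{s_l/2}$ (where $\partial_k$ corresponds to $i\xi_k$). Define the Sobolev space of multiple order $$\mathcal{H}^{\mathbf{s}}(\mathbb{R}^n)=\{u\in\mathcal{S}'(\mathbb{R}^n):\langle\langle D\rangle\rangle^{\mathbf{s}}u\in L^2(\mathbb{R}^n)\},\qquad \|u\|_{\mathcal{H}^{\mathbf{s}}}=\|\langle\langle D\rangle\rangle^{\mathbf{s}}u\|_{L^2},$$ and put $\|u\|_{\mathcal{H}^{\mathbf{s}}}=\infty$ for $u\in\mathcal{D}'(\mathbb{R}^n)\setminus\mathcal{H}^{\mathbf{s}}(\mathbb{R}^n)$.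 For $\chi\in C_0^\infty(\mathbb{R}^n)\setminus\{0\}$ let $\tau_y\chi=\chi(\cdot-y)$ and, for $u\in\mathcal{D}'(\mathbb{R}^n)$, $$\|u\|_{\mathbf{s},2,\chi}=\Bigl(\int_{\mathbb{R}^n}\|u\,\tau_y\chi\|_{\mathcal{H}^{\mathbf{s}}}^2\,dy\Bigr)^{1/2}\in[0,\infty].$$ The Kato-Sobolev space $\mathcal{K}_2^{\mathbf{s}}(\mathbb{R}^n)$ is the set of those $u\in\mathcal{D}'(\mathbb{R}^n)$ for which there is $\chi\in C_0^\infty(\mathbb{R}^n)\setminus\{0\}$ such that $y\mapsto\|u\,\tau_y\chi\|_{\mathcal{H}^{\mathbf{s}}}$ is a finite-valued measurable function belonging to $L^2(\mathbb{R}^n)$. Then $\mathcal{H}^{\mathbf{s}}(\mathbb{R}^n)=\mathcal{K}_2^{\mathbf{s}}(\mathbb{R}^n)$ as subsets of $\mathcal{D}'(\mathbb{R}^n)$, with equivalent norms: for every $\chi\in C_0^\infty(\mathbb{R}^n)\setminus\{0\}$ there is a constant $C\ge1$ such that for every $u\in\mathcal{D}'(\mathbb{R}^n)$ $$\|u\|_{\mathcal{H}^{\mathbf{s}}}\le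 C\,\|u\|_{\mathbf{s},2,\chi}\quad\text{and}\quad\|u\|_{\mathbf{s},2,\chi}\le C\,\|u\|_{\mathcal{H}^{\mathbf{s}}}.$$ -/

import Mathlib

open MeasureTheory
open scoped Distributions SchwartzMap ENNReal NNReal

noncomputable section

namespace KatoSobolev

variable {n j : ℕ}

/-- Complex-valued distributions on `ℝⁿ` (Mathlib's: continuous `ℝ`-linear maps from the real test
functions to `ℂ`, which is the same as continuous `ℂ`-linear functionals on the complex ones). -/
abbrev Dist (n : ℕ) : Type :=
  𝓓'((⊤ : TopologicalSpace.Opens (EuclideanSpace ℝ (Fin n))), ℂ)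

/-- Complex-valued test functions `C₀^∞(ℝⁿ)`. -/
abbrev CTest (n : ℕ) : Type :=
  𝓓((⊤ : TopologicalSpace.Opens (EuclideanSpace ℝ (Fin n))), ℂ)

/-- Real-valued test functions on `ℝⁿ`. -/
abbrev RTest (n : ℕ) : Type :=
  𝓓((⊤ : TopologicalSpace.Opens (EuclideanSpace ℝ (Fin n))), ℝ)

/-- Tempered distributions `𝓢'(ℝⁿ)`. -/
abbrev TempDist (n : ℕ) : Type := 𝓢'(EuclideanSpace ℝ (Fin n), ℂ)

/-- The symbol of `(1 - Δ₁)^{s₁/2} ⊗ ⋯ ⊗ (1 - Δⱼ)^{sⱼ/2}`, where `Δ_l` is the Laplacian in the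
variables `x_k` with `b k = l`. The factor `2π` is due to the kernel `exp (-2πi⟨x, ξ⟩)` of
Mathlib's Fourier transform. -/
def symbol (b : Fin n → Fin j) (s : Fin j → ℝ) (ξ : EuclideanSpace ℝ (Fin n)) : ℝ :=
  ∏ l, (1 + (2 * Real.pi) ^ 2 * ∑ k with b k = l, ξ k ^ 2) ^ (s l / 2)

/-- The symbol is smooth with all derivatives polynomially bounded, so that multiplication
by it (and the Fourier multiplier it defines) makes sense on tempered distributions. -/
theorem hasTemperateGrowth_symbol (b : Fin n → Fin j) (s : Fin j → ℝ) :
    (fun ξ ↦ (symbol b s ξ : ℂ)).HasTemperateGrowth := by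
  have key (l : Fin j) : (fun ξ : EuclideanSpace ℝ (Fin n) ↦
      (1 + (2 * Real.pi) ^ 2 * ∑ k with b k = l, ξ k ^ 2) ^ (s l / 2)).HasTemperateGrowth := by
    let P : EuclideanSpace ℝ (Fin n) →L[ℝ] EuclideanSpace ℝ (Fin n) :=
      LinearMap.toContinuousLinearMap
        { toFun := fun ξ ↦ WithLp.toLp 2 fun k ↦ if b k = l then 2 * Real.pi * ξ k else 0
          map_add' := fun x y ↦ by ext k; by_cases h : b k = l <;> simp [h, mul_add]
          map_smul' := fun c x ↦ by ext k; by_cases h : b k = l <;> simp [h]; ring }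
    have h := (Function.hasTemperateGrowth_one_add_norm_sq_rpow
      (EuclideanSpace ℝ (Fin n)) (s l / 2)).comp P.hasTemperateGrowth
    refine (congrArg Function.HasTemperateGrowth (funext fun ξ ↦ ?_)).mp h
    have : ‖P ξ‖ ^ 2 = (2 * Real.pi) ^ 2 * ∑ k with b k = l, ξ k ^ 2 := by
      rw [EuclideanSpace.real_norm_sq_eq, Finset.mul_sum, Finset.sum_filter]
      refine Finset.sum_congr rfl fun k _ ↦ ?_
      by_cases h : b k = l <;> simp [P, h]; ring
    simp only [Function.comp_apply, this]
  have hprod (t : Finset (Fin j)) : (fun ξ : EuclideanSpace ℝ (Fin n) ↦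
      ∏ l ∈ t, (1 + (2 * Real.pi) ^ 2 * ∑ k with b k = l, ξ k ^ 2) ^ (s l / 2)
      ).HasTemperateGrowth := by
    induction t using Finset.induction_on with
    | empty => simp
    | insert l t hl ih =>
      simp only [Finset.prod_insert hl]
      exact (key l).mul ih
  exact Function.HasTemperateGrowth.comp Function.Complex.hasTemperateGrowth_ofReal (hprod Finset.univ)

/-- The operator `⟨⟨D⟩⟩^s = (1 - Δ₁)^{s₁/2} ⊗ ⋯ ⊗ (1 - Δⱼ)^{sⱼ/2}` on tempered distributions. -/
def bessel (b : Fin n → Fin j) (s : Fin j → ℝ) : TempDist n →L[ℂ] TempDist n :=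
  TemperedDistribution.fourierMultiplierCLM ℂ (fun ξ ↦ (symbol b s ξ : ℂ))

/-- A real test function, regarded as a (complex-valued) Schwartz function. -/
def RTest.toSchwartz (φ : RTest n) : 𝓢(EuclideanSpace ℝ (Fin n), ℂ) :=
  HasCompactSupport.toSchwartzMap (f := fun x ↦ (φ x : ℂ))
    (φ.hasCompactSupport.comp_left (g := ((↑) : ℝ → ℂ)) Complex.ofReal_zero)
    (Complex.ofRealCLM.contDiff.comp φ.contDiff)

/-- The distribution `u` is (the restriction to test functions of) the tempered distribution `U`.
Such a `U` is unique, as test functions are dense among the Schwartz functions. -/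
def IsRestrictionOf (u : Dist n) (U : TempDist n) : Prop :=
  ∀ φ : RTest n, u φ = U φ.toSchwartz

/-- The Sobolev space of multiple order `H^s(ℝⁿ)`: the (tempered) distributions `u` for which
`⟨⟨D⟩⟩^s u` is an `L²` function. -/
def sobolevSpace (b : Fin n → Fin j) (s : Fin j → ℝ) : Set (Dist n) :=
  {u | ∃ U : TempDist n, IsRestrictionOf u U ∧
    ∃ f : Lp ℂ 2 (volume : Measure (EuclideanSpace ℝ (Fin n))), bessel b s U = f}

/-- `‖u‖_{H^s} = ‖⟨⟨D⟩⟩^s u‖_{L²}`, with the value `∞` if `u` is not in `H^s`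
(the infimum is over at most one function `f`). -/
def sobolevNorm (b : Fin n → Fin j) (s : Fin j → ℝ) (u : Dist n) : ℝ≥0∞ :=
  ⨅ (U : TempDist n) (_ : IsRestrictionOf u U)
    (f : Lp ℂ 2 (volume : Measure (EuclideanSpace ℝ (Fin n)))) (_ : bessel b s U = f), ‖f‖ₑ

/-- Multiplication of a real test function by a complex one. -/
def testMul (χ : CTest n) : RTest n →L[ℝ] CTest n :=
  TestFunction.limitCLM ℝ
    (fun φ ↦ ⟨fun x ↦ (φ x : ℂ) * χ x,
      (Complex.ofRealCLM.contDiff.comp φ.contDiff).mul χ.contDiff,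
      χ.hasCompactSupport.mul_left, fun _ _ ↦ trivial⟩)
    (fun K hK ↦ TestFunction.ofSupportedInCLM ℝ hK ∘L
      ContDiffMapSupportedIn.bilinLeftCLM (ContinuousLinearMap.lsmul ℝ ℝ) χ.contDiff)
    (fun _ _ _ ↦ by ext; simp)

/-- The product `u χ`, the distribution `φ ↦ ⟨u, χ φ⟩ = ⟨u, Re (χ φ)⟩ + i ⟨u, Im (χ φ)⟩`. -/
def distMul (u : Dist n) (χ : CTest n) : Dist n where
  toFun φ := u (TestFunction.postcompCLM Complex.reCLM (testMul χ φ)) +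
    Complex.I * u (TestFunction.postcompCLM Complex.imCLM (testMul χ φ))
  map_add' φ ψ := by simp only [map_add]; ring
  map_smul' c φ := by simp only [map_smul, RingHom.id_apply, Complex.real_smul]; ring
  cont := by
    have hu : Continuous u := u.cont
    fun_prop

/-- The translate `τ_y χ = χ(· - y)`. -/
def translate (y : EuclideanSpace ℝ (Fin n)) (χ : CTest n) : CTest n where
  toFun x := χ (x - y)
  contDiff' := χ.contDiff.comp (contDiff_id.sub contDiff_const)
  hasCompactSupport' := χ.hasCompactSupport.comp_homeomorph (Homeomorph.subRight y)
  tsupport_subset' := fun _ _ ↦ trivial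

/-- `‖u‖_{s,p,χ} = (∫ ‖u τ_y χ‖_{H^s}^p dy)^{1/p}` for a finite exponent `p`. -/
def katoNorm (b : Fin n → Fin j) (s : Fin j → ℝ) (p : ℝ) (χ : CTest n) (u : Dist n) : ℝ≥0∞ :=
  (∫⁻ y, sobolevNorm b s (distMul u (translate y χ)) ^ p) ^ (1 / p)

/-- The Kato-Sobolev space `K_p^s(ℝⁿ)` for a finite exponent `p`: the distributions `u` such that,
for some test function `χ ≠ 0`, `y ↦ ‖u τ_y χ‖_{H^s}` is a (finite) function belonging
to `L^p(ℝⁿ)`. -/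
def katoSobolevSpace (b : Fin n → Fin j) (s : Fin j → ℝ) (p : ℝ) : Set (Dist n) :=
  {u | ∃ χ : CTest n, χ ≠ 0 ∧ (∀ y, distMul u (translate y χ) ∈ sobolevSpace b s) ∧
    AEMeasurable (fun y ↦ sobolevNorm b s (distMul u (translate y χ))) ∧
    katoNorm b s p χ u < ∞}

end KatoSobolev

end

/-!
A product of Schwartz functions has the convolution of the Fourier transforms as its Fourier
transform. Hence `𝓕 (f τ_y g) ξ`, as a function of `y` for fixed `ξ`, is the Fourier transform of
`η ↦ 𝓕 f (ξ - η) 𝓕 g η`, and Plancherel's theorem in `y` gives, with `σ` the symbol of `⟨⟨D⟩⟩^s`,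
`∫ ‖f τ_y g‖² dy = ∫∫ σ(ξ)² |𝓕 f (ξ - η)|² |𝓕 g η|² dη dξ`. By Peetre's inequality
`σ(ξ) ≤ C σ(ξ - η) σ'(η)`, where `σ'` is the symbol of order `|s|`, the right side is at most a
multiple of `‖f‖²` (`lintegral_schwartzNorm_translate_le`). This bound for Schwartz functions is the
only analytic estimate that the equivalence of norms needs, applied with order `s` and with order
`-s`. That `u τ_y χ` lies in the Sobolev space for every `y`, and not just almost every one, follows
from the boundedness of multiplication by Schwartz functions (`exists_schwartzNorm_mul_le`).

The passage to distributions is by duality: `sobolevNorm_le_iff` says that the Sobolev norm of order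
`s` of a distribution `u` is its norm as a functional on the test functions with the norm of order
`-s`. This also makes `y ↦ ‖u τ_y χ‖` lower semicontinuous, hence measurable, for every
distribution `u` (`measurable_sobolevNorm_translate`).

* For `‖u‖_{s,2,χ} ≤ C ‖u‖`, approximate `⟨⟨D⟩⟩^s u` in `L²` by Schwartz functions and use Fatou's
  lemma (`katoNorm_le_mul_sobolevNorm`).
* For `‖u‖ ≤ C ‖u‖_{s,2,χ}`, take a lattice and a dual window `χ'` such that the translates of
  `χ χ'` by the lattice form a partition of unity (`exists_dual_window`). For each `y` and each test
  function `φ` this gives `⟨u, φ⟩ = ∑ₖ ⟨u τ_{k+y} χ, φ τ_{k+y} χ'⟩`, where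
  `|⟨u τ_{k+y} χ, φ τ_{k+y} χ'⟩| ≤ ‖u τ_{k+y} χ‖_s ‖φ τ_{k+y} χ'‖_{-s}`. Integration in `y`
  over a fundamental domain turns the sum into an integral over `ℝⁿ`, and the Cauchy–Schwarz
  inequality leaves `‖u‖_{s,2,χ}` times the norm `‖φ‖_{-s,2,χ'} ≤ C ‖φ‖_{-s}`
  (`sobolevNorm_le_mul_katoNorm`).
-/

noncomputable section

namespace KatoSobolev

open FourierTransform

variable {n j : ℕ}

/-! ### The symbol -/

theorem symbol_pos (b : Fin n → Fin j) (s : Fin j → ℝ) (ξ : EuclideanSpace ℝ (Fin n)) :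
    0 < symbol b s ξ :=
  Finset.prod_pos fun _ _ ↦ by positivity

theorem symbol_neg_arg (b : Fin n → Fin j) (s : Fin j → ℝ) (ξ : EuclideanSpace ℝ (Fin n)) :
    symbol b s (-ξ) = symbol b s ξ := by
  simp [symbol]

theorem symbol_mul_symbol_neg (b : Fin n → Fin j) (s : Fin j → ℝ)
    (ξ : EuclideanSpace ℝ (Fin n)) : symbol b s ξ * symbol b (-s) ξ = 1 := by
  rw [symbol, symbol, ← Finset.prod_mul_distrib]
  refine Finset.prod_eq_one fun l _ ↦ ?_
  rw [← Real.rpow_add (by positivity)]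
  simp [neg_div]

theorem continuous_symbol (b : Fin n → Fin j) (s : Fin j → ℝ) : Continuous (symbol b s) := by
  have h := Complex.continuous_re.comp (hasTemperateGrowth_symbol b s).1.continuous
  simpa [Function.comp_def] using h

/-- Peetre's inequality for a single factor. -/
theorem rpow_le_two_rpow_mul {x y z t : ℝ} (hx : 1 ≤ x) (hy : 1 ≤ y) (hz : 1 ≤ z)
    (hxy : x ≤ 2 * y * z) (hyx : y ≤ 2 * x * z) :
    x ^ t ≤ 2 ^ |t| * (y ^ t * z ^ |t|) := by
  have hx0 : 0 < x := by linarith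
  have hy0 : 0 < y := by linarith
  have hz0 : 0 < z := by linarith
  rcases le_total 0 t with ht | ht
  · rw [abs_of_nonneg ht, ← Real.mul_rpow hy0.le hz0.le, ← Real.mul_rpow (by norm_num) (by positivity),
      ← mul_assoc]
    exact Real.rpow_le_rpow hx0.le hxy ht
  · have key : y ^ (-t) ≤ 2 ^ (-t) * (x ^ (-t) * z ^ (-t)) := by
      rw [← Real.mul_rpow hx0.le hz0.le, ← Real.mul_rpow (by norm_num) (by positivity), ← mul_assoc]
      exact Real.rpow_le_rpow hy0.le hyx (by linarith)
    have h1 : x ^ t * x ^ (-t) = 1 := by rw [← Real.rpow_add hx0]; simp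
    have h2 : y ^ t * y ^ (-t) = 1 := by rw [← Real.rpow_add hy0]; simp
    rw [abs_of_nonpos ht]
    calc x ^ t = x ^ t * y ^ t * y ^ (-t) := by rw [mul_assoc, h2, mul_one]
      _ ≤ x ^ t * y ^ t * (2 ^ (-t) * (x ^ (-t) * z ^ (-t))) := by gcongr
      _ = x ^ t * x ^ (-t) * (2 ^ (-t) * (y ^ t * z ^ (-t))) := by ring
      _ = _ := by rw [h1, one_mul]

/-- **Peetre's inequality** for the symbol. -/
theorem symbol_le (b : Fin n → Fin j) (s : Fin j → ℝ) (ξ η : EuclideanSpace ℝ (Fin n)) :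
    symbol b s ξ ≤ (∏ l, 2 ^ |s l / 2|) * (symbol b s (ξ - η) * symbol b |s| η) := by
  have key (x y : EuclideanSpace ℝ (Fin n)) (l : Fin j) :
      1 + (2 * Real.pi) ^ 2 * ∑ k with b k = l, (x k + y k) ^ 2 ≤
        2 * (1 + (2 * Real.pi) ^ 2 * ∑ k with b k = l, x k ^ 2) *
          (1 + (2 * Real.pi) ^ 2 * ∑ k with b k = l, y k ^ 2) := by
    have h1 : ∑ k with b k = l, (x k + y k) ^ 2 ≤
        2 * ∑ k with b k = l, x k ^ 2 + 2 * ∑ k with b k = l, y k ^ 2 := by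
      rw [Finset.mul_sum, Finset.mul_sum, ← Finset.sum_add_distrib]
      exact Finset.sum_le_sum fun k _ ↦ by nlinarith [sq_nonneg (x k - y k)]
    have h2 : 0 ≤ (2 * Real.pi) ^ 2 * ∑ k with b k = l, x k ^ 2 := by positivity
    have h3 : 0 ≤ (2 * Real.pi) ^ 2 * ∑ k with b k = l, y k ^ 2 := by positivity
    have h4 := mul_le_mul_of_nonneg_left h1 (sq_nonneg (2 * Real.pi))
    nlinarith [mul_nonneg h2 h3]
  have one_le (x : EuclideanSpace ℝ (Fin n)) (l : Fin j) :
      1 ≤ 1 + (2 * Real.pi) ^ 2 * ∑ k with b k = l, x k ^ 2 :=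
    le_add_of_nonneg_right (by positivity)
  rw [symbol, symbol, symbol, ← Finset.prod_mul_distrib, ← Finset.prod_mul_distrib]
  refine Finset.prod_le_prod (fun l _ ↦ by positivity) fun l _ ↦ ?_
  have h := rpow_le_two_rpow_mul (t := s l / 2) (one_le ξ l) (one_le (ξ - η) l) (one_le η l)
    (by simpa using key (ξ - η) η l)
    (by simpa [sub_eq_add_neg] using key ξ (-η) l)
  rwa [abs_div, abs_two] at h ⊢

/-! ### Sobolev norms of Schwartz functions -/

/-- The operator `⟨⟨D⟩⟩^s` on Schwartz functions. -/
def schwartzBessel (b : Fin n → Fin j) (s : Fin j → ℝ) :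
    𝓢(EuclideanSpace ℝ (Fin n), ℂ) →L[ℂ] 𝓢(EuclideanSpace ℝ (Fin n), ℂ) :=
  SchwartzMap.fourierMultiplierCLM ℂ (fun ξ ↦ (symbol b s ξ : ℂ))

/-- The norm `‖⟨⟨D⟩⟩^s f‖_{L²}` of a Schwartz function `f`. -/
def schwartzNorm (b : Fin n → Fin j) (s : Fin j → ℝ)
    (f : 𝓢(EuclideanSpace ℝ (Fin n), ℂ)) : ℝ≥0∞ :=
  ‖(schwartzBessel b s f).toLp 2‖ₑ

theorem fourier_schwartzBessel_apply (b : Fin n → Fin j) (s : Fin j → ℝ)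
    (f : 𝓢(EuclideanSpace ℝ (Fin n), ℂ)) (ξ : EuclideanSpace ℝ (Fin n)) :
    𝓕 (schwartzBessel b s f) ξ = symbol b s ξ * 𝓕 f ξ := by
  rw [schwartzBessel, SchwartzMap.fourierMultiplierCLM_apply, FourierTransform.fourier_fourierInv_eq,
    SchwartzMap.smulLeftCLM_apply_apply (hasTemperateGrowth_symbol b s), smul_eq_mul]

theorem schwartzBessel_neg_schwartzBessel (b : Fin n → Fin j) (s : Fin j → ℝ)
    (f : 𝓢(EuclideanSpace ℝ (Fin n), ℂ)) :
    schwartzBessel b (-s) (schwartzBessel b s f) = f := by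
  rw [schwartzBessel, schwartzBessel, SchwartzMap.fourierMultiplierCLM_fourierMultiplierCLM_apply
    (hasTemperateGrowth_symbol b (-s)) (hasTemperateGrowth_symbol b s)]
  have : ((fun ξ ↦ (symbol b (-s) ξ : ℂ)) * fun ξ ↦ (symbol b s ξ : ℂ)) = fun _ ↦ 1 := by
    ext ξ
    rw [Pi.mul_apply, ← Complex.ofReal_mul, mul_comm, symbol_mul_symbol_neg, Complex.ofReal_one]
  rw [this, SchwartzMap.fourierMultiplierCLM_const]
  simp

theorem schwartzBessel_schwartzBessel_neg (b : Fin n → Fin j) (s : Fin j → ℝ)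
    (f : 𝓢(EuclideanSpace ℝ (Fin n), ℂ)) :
    schwartzBessel b s (schwartzBessel b (-s) f) = f := by
  simpa using schwartzBessel_neg_schwartzBessel b (-s) f

theorem fourier_fourier_apply (f : 𝓢(EuclideanSpace ℝ (Fin n), ℂ))
    (x : EuclideanSpace ℝ (Fin n)) : 𝓕 (𝓕 f) x = f (-x) := by
  have h := congrArg (fun g : 𝓢(EuclideanSpace ℝ (Fin n), ℂ) ↦ g (-x))
    (FourierTransform.fourierInv_fourier_eq (F := 𝓢(EuclideanSpace ℝ (Fin n), ℂ)) f)
  rw [SchwartzMap.fourierInv_apply_eq] at h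
  simpa using h

theorem fourierInv_apply_eq_neg (f : 𝓢(EuclideanSpace ℝ (Fin n), ℂ))
    (x : EuclideanSpace ℝ (Fin n)) : 𝓕⁻ f x = 𝓕 f (-x) := by
  rw [SchwartzMap.fourierInv_apply_eq]
  simp

/-- As the symbol is even, the transpose of `⟨⟨D⟩⟩^s` is `⟨⟨D⟩⟩^s`. -/
theorem bessel_apply (b : Fin n → Fin j) (s : Fin j → ℝ) (U : TempDist n)
    (φ : 𝓢(EuclideanSpace ℝ (Fin n), ℂ)) : bessel b s U φ = U (schwartzBessel b s φ) := by
  rw [bessel, TemperedDistribution.fourierMultiplierCLM_apply_apply]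
  congr 1
  rw [schwartzBessel, SchwartzMap.fourierMultiplierCLM_apply]
  have h : SchwartzMap.smulLeftCLM ℂ (fun ξ ↦ (symbol b s ξ : ℂ)) (𝓕⁻ φ) =
      𝓕 (𝓕 (SchwartzMap.smulLeftCLM ℂ (fun ξ ↦ (symbol b s ξ : ℂ)) (𝓕 φ))) := by
    ext ξ
    rw [fourier_fourier_apply, SchwartzMap.smulLeftCLM_apply_apply (hasTemperateGrowth_symbol b s),
      SchwartzMap.smulLeftCLM_apply_apply (hasTemperateGrowth_symbol b s), symbol_neg_arg,
      fourierInv_apply_eq_neg]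
  rw [h]
  ext x
  rw [fourier_fourier_apply, fourierInv_apply_eq_neg]

theorem enorm_toLp_sq (f : 𝓢(EuclideanSpace ℝ (Fin n), ℂ)) :
    ‖f.toLp 2‖ₑ ^ 2 = ∫⁻ x, ‖f x‖ₑ ^ 2 := by
  rw [Lp.enorm_def, eLpNorm_congr_ae (f.coeFn_toLp 2 volume),
    eLpNorm_eq_lintegral_rpow_enorm_toReal (by norm_num) (by norm_num)]
  simp only [ENNReal.toReal_ofNat, one_div, ENNReal.rpow_ofNat]
  rw [← ENNReal.rpow_natCast, ← ENNReal.rpow_mul]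
  simp

theorem lintegral_fourier_sq (f : 𝓢(EuclideanSpace ℝ (Fin n), ℂ)) :
    ∫⁻ ξ, ‖𝓕 f ξ‖ₑ ^ 2 = ∫⁻ x, ‖f x‖ₑ ^ 2 := by
  rw [← enorm_toLp_sq, ← enorm_toLp_sq, ← ofReal_norm, ← ofReal_norm,
    SchwartzMap.norm_fourier_toL2_eq]

theorem schwartzNorm_sq (b : Fin n → Fin j) (s : Fin j → ℝ)
    (f : 𝓢(EuclideanSpace ℝ (Fin n), ℂ)) :
    schwartzNorm b s f ^ 2 = ∫⁻ ξ, (ENNReal.ofReal (symbol b s ξ) * ‖𝓕 f ξ‖ₑ) ^ 2 := by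
  rw [schwartzNorm, enorm_toLp_sq, ← lintegral_fourier_sq]
  refine lintegral_congr fun ξ ↦ ?_
  rw [fourier_schwartzBessel_apply, enorm_mul, ← ofReal_norm, Complex.norm_real,
    Real.norm_of_nonneg (symbol_pos b s ξ).le]

theorem schwartzNorm_ne_top (b : Fin n → Fin j) (s : Fin j → ℝ)
    (f : 𝓢(EuclideanSpace ℝ (Fin n), ℂ)) : schwartzNorm b s f ≠ ∞ :=
  enorm_ne_top

theorem eq_zero_of_schwartzNorm_eq_zero {b : Fin n → Fin j} {s : Fin j → ℝ}
    {f : 𝓢(EuclideanSpace ℝ (Fin n), ℂ)} (h : schwartzNorm b s f = 0) : f = 0 := by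
  rw [schwartzNorm, enorm_eq_zero] at h
  have h0 : schwartzBessel b s f = 0 :=
    SchwartzMap.injective_toLp 2 volume (h.trans ((SchwartzMap.toLpCLM ℂ ℂ 2 volume).map_zero).symm)
  rw [← schwartzBessel_neg_schwartzBessel b s f, h0, map_zero]

/-! ### Products with translates -/

/-- The pointwise product of two Schwartz functions. -/
def schwartzMul (f g : 𝓢(EuclideanSpace ℝ (Fin n), ℂ)) : 𝓢(EuclideanSpace ℝ (Fin n), ℂ) :=
  SchwartzMap.pairing (ContinuousLinearMap.mul ℂ ℂ) f g

@[simp]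
theorem schwartzMul_apply (f g : 𝓢(EuclideanSpace ℝ (Fin n), ℂ)) (x : EuclideanSpace ℝ (Fin n)) :
    schwartzMul f g x = f x * g x := by
  simp [schwartzMul]

/-- The function `f(ξ - ·)`. -/
def schwartzReflect (ξ : EuclideanSpace ℝ (Fin n)) (f : 𝓢(EuclideanSpace ℝ (Fin n), ℂ)) :
    𝓢(EuclideanSpace ℝ (Fin n), ℂ) :=
  SchwartzMap.compCLMOfAntilipschitz (g := fun η ↦ ξ - η) (K := 1) ℂ (by fun_prop)
    (fun _ _ ↦ by simp [edist_dist, dist_eq_norm, norm_sub_rev]) f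

@[simp]
theorem schwartzReflect_apply (ξ : EuclideanSpace ℝ (Fin n))
    (f : 𝓢(EuclideanSpace ℝ (Fin n), ℂ)) (η : EuclideanSpace ℝ (Fin n)) :
    schwartzReflect ξ f η = f (ξ - η) :=
  rfl

theorem fourier_schwartzMul_apply (f g : 𝓢(EuclideanSpace ℝ (Fin n), ℂ))
    (ξ : EuclideanSpace ℝ (Fin n)) :
    𝓕 (schwartzMul f g) ξ = ∫ η, 𝓕 f (ξ - η) * 𝓕 g η := by
  have h : 𝓕 (schwartzMul f g) =
      SchwartzMap.convolution (ContinuousLinearMap.mul ℂ ℂ) (𝓕 g) (𝓕 f) := by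
    refine (FourierTransform.fourierCLE ℂ 𝓢(EuclideanSpace ℝ (Fin n), ℂ)).injective ?_
    simp only [FourierTransform.fourierCLE_apply, SchwartzMap.fourier_convolution]
    ext x
    simp [fourier_fourier_apply, mul_comm]
  rw [h, SchwartzMap.convolution_apply]
  simp [convolution, mul_comm]

theorem fourier_compSubConst_apply (y : EuclideanSpace ℝ (Fin n))
    (g : 𝓢(EuclideanSpace ℝ (Fin n), ℂ)) (η : EuclideanSpace ℝ (Fin n)) :
    𝓕 (g.compSubConstCLM ℂ y) η = Real.fourierChar (-inner ℝ η y) • 𝓕 g η := by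
  have h := congrFun (VectorFourier.fourierIntegral_comp_add_right Real.fourierChar volume
    (innerₗ (EuclideanSpace ℝ (Fin n))) g (-y)) η
  have he : -inner ℝ η y = innerₗ (EuclideanSpace ℝ (Fin n)) (-y) η := by
    simp [real_inner_comm]
  rw [he]
  refine Eq.trans ?_ h
  change VectorFourier.fourierIntegral Real.fourierChar volume _ (fun v ↦ g (v - y)) η = _
  simp only [Function.comp_def, sub_eq_add_neg]

/-- For fixed `ξ`, the function `y ↦ 𝓕 (f · τ_y g) ξ` is itself a Fourier transform. -/
theorem fourier_schwartzMul_translate (f g : 𝓢(EuclideanSpace ℝ (Fin n), ℂ))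
    (y ξ : EuclideanSpace ℝ (Fin n)) :
    𝓕 (schwartzMul f (g.compSubConstCLM ℂ y)) ξ =
      𝓕 (schwartzMul (schwartzReflect ξ (𝓕 f)) (𝓕 g)) y := by
  rw [fourier_schwartzMul_apply,
    SchwartzMap.fourier_coe (schwartzMul (schwartzReflect ξ (𝓕 f)) _), Real.fourier_eq]
  refine integral_congr_ae (.of_forall fun η ↦ ?_)
  simp only [fourier_compSubConst_apply, schwartzMul_apply, schwartzReflect_apply, Circle.smul_def,
    smul_eq_mul]
  ring

theorem measurable_fourier_schwartzMul_translate (f g : 𝓢(EuclideanSpace ℝ (Fin n), ℂ)) :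
    Measurable fun p : EuclideanSpace ℝ (Fin n) × EuclideanSpace ℝ (Fin n) ↦
      𝓕 (schwartzMul f (g.compSubConstCLM ℂ p.1)) p.2 := by
  simp only [fourier_schwartzMul_apply, fourier_compSubConst_apply]
  have hf := (𝓕 f).continuous
  have hg := (𝓕 g).continuous
  have hc : Continuous fun q : (EuclideanSpace ℝ (Fin n) × EuclideanSpace ℝ (Fin n)) ×
      EuclideanSpace ℝ (Fin n) ↦
      𝓕 f (q.1.2 - q.2) * (Real.fourierChar (-inner ℝ q.2 q.1.1) • 𝓕 g q.2) := by
    simp only [Circle.smul_def]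
    have := Real.continuous_fourierChar
    fun_prop
  exact (hc.stronglyMeasurable.integral_prod_right' (ν := volume)).measurable

theorem measurable_schwartzNorm_translate (b : Fin n → Fin j) (s : Fin j → ℝ)
    (f g : 𝓢(EuclideanSpace ℝ (Fin n), ℂ)) :
    Measurable fun y ↦ schwartzNorm b s (schwartzMul f (g.compSubConstCLM ℂ y)) ^ 2 := by
  simp only [schwartzNorm_sq]
  have h1 := measurable_fourier_schwartzMul_translate f g
  have h2 := (continuous_symbol b s).measurable
  refine Measurable.lintegral_prod_right (f := fun y ξ ↦ _) ?_
  exact (((h2.comp measurable_snd).ennreal_ofReal).mul h1.enorm).pow_const 2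

theorem ofReal_symbol_le (b : Fin n → Fin j) (s : Fin j → ℝ) (ξ η : EuclideanSpace ℝ (Fin n)) :
    ENNReal.ofReal (symbol b s ξ) ≤ ENNReal.ofReal (∏ l, 2 ^ |s l / 2|) *
      (ENNReal.ofReal (symbol b s (ξ - η)) * ENNReal.ofReal (symbol b |s| η)) := by
  rw [← ENNReal.ofReal_mul (symbol_pos b s _).le, ← ENNReal.ofReal_mul (by positivity)]
  exact ENNReal.ofReal_le_ofReal (symbol_le b s ξ η)

/-- The integrated bound `∫ ‖f τ_y g‖² dy ≤ C ‖f‖²` in Sobolev norms. By Plancherel in `y`, the left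
side is `∫∫ σ(ξ)² |𝓕 f (ξ - η)|² |𝓕 g η|² dη dξ`, and Peetre's inequality separates the variables. -/
theorem lintegral_schwartzNorm_translate_le (b : Fin n → Fin j) (s : Fin j → ℝ)
    (f g : 𝓢(EuclideanSpace ℝ (Fin n), ℂ)) :
    ∫⁻ y, schwartzNorm b s (schwartzMul f (g.compSubConstCLM ℂ y)) ^ 2 ≤
      (ENNReal.ofReal (∏ l, 2 ^ |s l / 2|) * schwartzNorm b |s| g * schwartzNorm b s f) ^ 2 := by
  have h1 := measurable_fourier_schwartzMul_translate f g
  have h2 := (continuous_symbol b s).measurable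
  have h2' := (continuous_symbol b |s|).measurable
  have hf := (𝓕 f).continuous.measurable
  have hg := (𝓕 g).continuous.measurable
  set C := ENNReal.ofReal (∏ l, 2 ^ |s l / 2|)
  calc ∫⁻ y, schwartzNorm b s (schwartzMul f (g.compSubConstCLM ℂ y)) ^ 2
      = ∫⁻ ξ, ∫⁻ y, (ENNReal.ofReal (symbol b s ξ) *
          ‖𝓕 (schwartzMul f (g.compSubConstCLM ℂ y)) ξ‖ₑ) ^ 2 := by
        simp only [schwartzNorm_sq]
        refine lintegral_lintegral_swap (Measurable.aemeasurable ?_)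
        exact (((h2.comp measurable_snd).ennreal_ofReal).mul h1.enorm).pow_const 2
    _ = ∫⁻ ξ, ∫⁻ η, (ENNReal.ofReal (symbol b s ξ) * (‖𝓕 f (ξ - η)‖ₑ * ‖𝓕 g η‖ₑ)) ^ 2 := by
        refine lintegral_congr fun ξ ↦ ?_
        simp only [mul_pow, fourier_schwartzMul_translate]
        rw [lintegral_const_mul' _ _ (by simp), lintegral_const_mul' _ _ (by simp),
          lintegral_fourier_sq]
        simp [mul_pow]
    _ ≤ ∫⁻ ξ, ∫⁻ η, C ^ 2 * ((ENNReal.ofReal (symbol b s (ξ - η)) * ‖𝓕 f (ξ - η)‖ₑ) ^ 2 *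
          (ENNReal.ofReal (symbol b |s| η) * ‖𝓕 g η‖ₑ) ^ 2) := by
        refine lintegral_mono fun ξ ↦ lintegral_mono fun η ↦ ?_
        rw [← mul_pow, ← mul_pow]
        gcongr ?_ ^ 2
        calc _ ≤ _ := mul_le_mul_left (ofReal_symbol_le b s ξ η) _
          _ = _ := by ring
    _ = ∫⁻ η, ∫⁻ ξ, C ^ 2 * ((ENNReal.ofReal (symbol b s (ξ - η)) * ‖𝓕 f (ξ - η)‖ₑ) ^ 2 *
          (ENNReal.ofReal (symbol b |s| η) * ‖𝓕 g η‖ₑ) ^ 2) := by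
        refine lintegral_lintegral_swap (Measurable.aemeasurable ?_)
        simp only [Function.uncurry_def]
        fun_prop
    _ = ∫⁻ η, C ^ 2 * schwartzNorm b s f ^ 2 *
          (ENNReal.ofReal (symbol b |s| η) * ‖𝓕 g η‖ₑ) ^ 2 := by
        refine lintegral_congr fun η ↦ ?_
        rw [lintegral_const_mul' _ _ (by simp [C]), lintegral_mul_const' _ _ (by simp [ENNReal.mul_eq_top]),
          schwartzNorm_sq, ← mul_assoc]
        congr 2
        exact lintegral_sub_right_eq_self
          (fun ξ ↦ (ENNReal.ofReal (symbol b s ξ) * ‖𝓕 f ξ‖ₑ) ^ 2) η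
    _ = _ := by
        rw [lintegral_const_mul _ (by fun_prop), ← schwartzNorm_sq]
        ring

theorem sq_lintegral_mul_le {α : Type*} [MeasurableSpace α] (μ : Measure α) {f g : α → ℝ≥0∞}
    (hf : AEMeasurable f μ) (hg : AEMeasurable g μ) :
    (∫⁻ a, f a * g a ∂μ) ^ 2 ≤ (∫⁻ a, f a ^ 2 ∂μ) * ∫⁻ a, g a ^ 2 ∂μ := by
  have h := ENNReal.lintegral_mul_le_Lp_mul_Lq μ .two_two hf hg
  simp only [ENNReal.rpow_ofNat, Pi.mul_apply] at h
  calc _ ≤ _ := pow_le_pow_left' h 2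
    _ = _ := by
      rw [mul_pow, ← ENNReal.rpow_natCast, ← ENNReal.rpow_natCast, ← ENNReal.rpow_mul,
        ← ENNReal.rpow_mul]
      simp

/-- Multiplication by a Schwartz function is bounded in Sobolev norms. -/
theorem exists_schwartzNorm_mul_le (b : Fin n → Fin j) (s : Fin j → ℝ)
    (g : 𝓢(EuclideanSpace ℝ (Fin n), ℂ)) :
    ∃ C : ℝ≥0∞, C ≠ ∞ ∧ ∀ f, schwartzNorm b s (schwartzMul f g) ≤ C * schwartzNorm b s f := by
  set C := ENNReal.ofReal (∏ l, 2 ^ |s l / 2|)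
  -- `σ |𝓕 (f g)|` is at most `C` times the convolution of `σ |𝓕 f|`, in `L²`, and `G`, in `L¹`
  set G : EuclideanSpace ℝ (Fin n) → ℝ≥0∞ := fun η ↦ ENNReal.ofReal (symbol b |s| η) * ‖𝓕 g η‖ₑ
  have hGm : Measurable G := by
    have h2' := (continuous_symbol b |s|).measurable
    have hg := (𝓕 g).continuous.measurable
    fun_prop
  have hG : ∫⁻ η, G η ≠ ∞ := by
    have h := (𝓕 (schwartzBessel b |s| g)).integrable (μ := volume)
    refine ne_of_eq_of_ne (lintegral_congr fun η ↦ ?_) h.2.ne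
    rw [fourier_schwartzBessel_apply, enorm_mul, ← ofReal_norm (E := ℂ), Complex.norm_real,
      Real.norm_of_nonneg (symbol_pos b |s| η).le]
  refine ⟨C * ∫⁻ η, G η, ENNReal.mul_ne_top (by simp [C]) hG, fun f ↦ ?_⟩
  set F : EuclideanSpace ℝ (Fin n) → ℝ≥0∞ := fun ξ ↦ ENNReal.ofReal (symbol b s ξ) * ‖𝓕 f ξ‖ₑ
  have hFm : Measurable F := by
    have h2' := (continuous_symbol b s).measurable
    have hg := (𝓕 f).continuous.measurable
    fun_prop
  refine (ENNReal.pow_right_strictMono two_ne_zero).le_iff_le.mp ?_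
  have hpt (ξ : EuclideanSpace ℝ (Fin n)) :
      ENNReal.ofReal (symbol b s ξ) * ‖𝓕 (schwartzMul f g) ξ‖ₑ ≤ C * ∫⁻ η, F (ξ - η) * G η := by
    rw [fourier_schwartzMul_apply]
    calc _ ≤ ENNReal.ofReal (symbol b s ξ) * ∫⁻ η, ‖𝓕 f (ξ - η)‖ₑ * ‖𝓕 g η‖ₑ := by
          gcongr
          simpa using enorm_integral_le_lintegral_enorm fun η ↦ 𝓕 f (ξ - η) * 𝓕 g η
      _ = ∫⁻ η, ENNReal.ofReal (symbol b s ξ) * (‖𝓕 f (ξ - η)‖ₑ * ‖𝓕 g η‖ₑ) := by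
          rw [lintegral_const_mul' _ _ (by simp)]
      _ ≤ ∫⁻ η, C * (F (ξ - η) * G η) := by
          refine lintegral_mono fun η ↦ ?_
          calc _ ≤ _ := mul_le_mul_left (ofReal_symbol_le b s ξ η) _
            _ = _ := by simp only [F, G]; ring
      _ = _ := lintegral_const_mul' _ _ (by simp [C])
  -- Cauchy–Schwarz with respect to the finite measure with density `G`
  have hcs (ξ : EuclideanSpace ℝ (Fin n)) :
      (∫⁻ η, F (ξ - η) * G η) ^ 2 ≤ (∫⁻ η, F (ξ - η) ^ 2 * G η) * ∫⁻ η, G η := by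
    have h := sq_lintegral_mul_le (volume.withDensity G) (f := fun η ↦ F (ξ - η)) (g := fun _ ↦ 1)
      (by fun_prop) (by fun_prop)
    rw [lintegral_withDensity_eq_lintegral_mul _ hGm (by fun_prop),
      lintegral_withDensity_eq_lintegral_mul _ hGm (by fun_prop),
      lintegral_withDensity_eq_lintegral_mul _ hGm (by fun_prop)] at h
    simpa [mul_comm] using h
  calc schwartzNorm b s (schwartzMul f g) ^ 2
      ≤ ∫⁻ ξ, C ^ 2 * (∫⁻ η, G η) * ∫⁻ η, F (ξ - η) ^ 2 * G η := by
        rw [schwartzNorm_sq]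
        refine lintegral_mono fun ξ ↦ ?_
        calc _ ≤ (C * ∫⁻ η, F (ξ - η) * G η) ^ 2 := pow_le_pow_left' (hpt ξ) 2
          _ ≤ C ^ 2 * ((∫⁻ η, F (ξ - η) ^ 2 * G η) * ∫⁻ η, G η) := by
            rw [mul_pow]
            gcongr
            exact hcs ξ
          _ = _ := by ring
    _ = C ^ 2 * (∫⁻ η, G η) * ∫⁻ η, ∫⁻ ξ, F (ξ - η) ^ 2 * G η := by
        rw [lintegral_const_mul' _ _ (ENNReal.mul_ne_top (by simp [C]) hG)]
        congr 1
        refine lintegral_lintegral_swap (Measurable.aemeasurable ?_)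
        simp only [Function.uncurry_def]
        fun_prop
    _ = C ^ 2 * (∫⁻ η, G η) * ∫⁻ η, schwartzNorm b s f ^ 2 * G η := by
        congr 2 with η
        rw [lintegral_mul_const _ (by fun_prop), schwartzNorm_sq,
          lintegral_sub_right_eq_self (fun ξ ↦ F ξ ^ 2) η]
    _ = _ := by
        rw [lintegral_const_mul _ hGm]
        ring

/-! ### Complex test functions -/

/-- A complex test function, regarded as a Schwartz function. -/
def CTest.toSchwartz (φ : CTest n) : 𝓢(EuclideanSpace ℝ (Fin n), ℂ) :=
  φ.hasCompactSupport.toSchwartzMap φ.contDiff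

@[simp]
theorem CTest.toSchwartz_apply (φ : CTest n) (x : EuclideanSpace ℝ (Fin n)) :
    φ.toSchwartz x = φ x :=
  rfl

@[simp]
theorem RTest.toSchwartz_apply (φ : RTest n) (x : EuclideanSpace ℝ (Fin n)) :
    φ.toSchwartz x = φ x :=
  rfl

/-- The pointwise product of two complex test functions. -/
def CTest.mul (χ φ : CTest n) : CTest n where
  toFun x := χ x * φ x
  contDiff' := χ.contDiff.mul φ.contDiff
  hasCompactSupport' := φ.hasCompactSupport.mul_left
  tsupport_subset' := fun _ _ ↦ trivial

@[simp]
theorem CTest.mul_apply (χ φ : CTest n) (x : EuclideanSpace ℝ (Fin n)) :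
    χ.mul φ x = χ x * φ x :=
  rfl

@[simp]
theorem translate_apply (y : EuclideanSpace ℝ (Fin n)) (χ : CTest n)
    (x : EuclideanSpace ℝ (Fin n)) : translate y χ x = χ (x - y) :=
  rfl

@[simp]
theorem testMul_apply (χ : CTest n) (φ : RTest n) (x : EuclideanSpace ℝ (Fin n)) :
    testMul χ φ x = φ x * χ x :=
  rfl

theorem CTest.toSchwartz_mul (χ φ : CTest n) :
    (χ.mul φ).toSchwartz = schwartzMul χ.toSchwartz φ.toSchwartz := by
  ext x
  simp

theorem CTest.toSchwartz_translate (y : EuclideanSpace ℝ (Fin n)) (χ : CTest n) :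
    (translate y χ).toSchwartz = χ.toSchwartz.compSubConstCLM ℂ y := by
  ext x
  simp

/-- The extension of a distribution to a `ℂ`-linear functional on the complex test functions. -/
def extend (u : Dist n) : CTest n →ₗ[ℂ] ℂ where
  toFun φ := u (TestFunction.postcompCLM Complex.reCLM φ) +
    Complex.I * u (TestFunction.postcompCLM Complex.imCLM φ)
  map_add' φ ψ := by simp only [map_add]; ring
  map_smul' c φ := by
    have h1 : TestFunction.postcompCLM Complex.reCLM (c • φ) =
        c.re • TestFunction.postcompCLM Complex.reCLM φ -
          c.im • TestFunction.postcompCLM Complex.imCLM φ := by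
      ext x; simp
    have h2 : TestFunction.postcompCLM Complex.imCLM (c • φ) =
        c.re • TestFunction.postcompCLM Complex.imCLM φ +
          c.im • TestFunction.postcompCLM Complex.reCLM φ := by
      ext x; simp
    rw [h1, h2]
    simp only [map_sub, map_add, map_smul, Complex.real_smul, RingHom.id_apply, smul_eq_mul]
    conv_rhs => rw [← Complex.re_add_im c]
    linear_combination (-c.im * u (TestFunction.postcompCLM Complex.imCLM φ)) * Complex.I_mul_I

theorem extend_apply (u : Dist n) (φ : CTest n) :
    extend u φ = u (TestFunction.postcompCLM Complex.reCLM φ) +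
      Complex.I * u (TestFunction.postcompCLM Complex.imCLM φ) :=
  rfl

/-- A real test function, regarded as a complex-valued one. -/
def RTest.toComplex (φ : RTest n) : CTest n where
  toFun x := φ x
  contDiff' := Complex.ofRealCLM.contDiff.comp φ.contDiff
  hasCompactSupport' := φ.hasCompactSupport.comp_left (g := ((↑) : ℝ → ℂ)) Complex.ofReal_zero
  tsupport_subset' := fun _ _ ↦ trivial

@[simp]
theorem RTest.toComplex_apply (φ : RTest n) (x : EuclideanSpace ℝ (Fin n)) :
    φ.toComplex x = φ x :=
  rfl

theorem extend_toComplex (u : Dist n) (φ : RTest n) : extend u φ.toComplex = u φ := by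
  have h1 : TestFunction.postcompCLM Complex.reCLM φ.toComplex = φ := by ext x; simp
  have h2 : TestFunction.postcompCLM Complex.imCLM φ.toComplex = 0 := by ext x; simp
  rw [extend_apply, h1, h2, map_zero, mul_zero, add_zero]

theorem isRestrictionOf_iff (u : Dist n) (U : TempDist n) :
    IsRestrictionOf u U ↔ ∀ φ : CTest n, extend u φ = U φ.toSchwartz := by
  refine ⟨fun h φ ↦ ?_, fun h φ ↦ ?_⟩
  · have hφ : φ.toSchwartz = RTest.toSchwartz (TestFunction.postcompCLM Complex.reCLM φ) +
        Complex.I • RTest.toSchwartz (TestFunction.postcompCLM Complex.imCLM φ) := by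
      ext x
      simp [mul_comm Complex.I, Complex.re_add_im]
    rw [extend_apply, h, h, hφ, map_add, map_smul, smul_eq_mul]
  · rw [← extend_toComplex, h]
    rfl

theorem extend_distMul (u : Dist n) (χ φ : CTest n) :
    extend (distMul u χ) φ = extend u (χ.mul φ) := by
  have h (ψ : RTest n) : distMul u χ ψ = extend u (testMul χ ψ) := rfl
  rw [extend_apply, h, h, ← smul_eq_mul, ← map_smul, ← map_add]
  congr 1
  ext x
  have := Complex.re_add_im (φ x)
  simp only [add_apply, smul_apply, testMul_apply, TestFunction.postcompCLM_apply,
    Function.comp_apply, Complex.reCLM_apply, Complex.imCLM_apply, smul_eq_mul, CTest.mul_apply]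
  linear_combination χ x * this

/-! ### Duality -/

theorem integral_smul_eq_inner (f : Lp ℂ 2 (volume : Measure (EuclideanSpace ℝ (Fin n))))
    (g : 𝓢(EuclideanSpace ℝ (Fin n), ℂ)) :
    ∫ x, g x • f x = inner ℂ (star f) (g.toLp 2) := by
  rw [L2.inner_def]
  refine integral_congr_ae ?_
  filter_upwards [Lp.coeFn_star f, g.coeFn_toLp 2 volume] with x hx hx'
  rw [hx, hx']
  simp

theorem norm_Lp_star (f : Lp ℂ 2 (volume : Measure (EuclideanSpace ℝ (Fin n)))) :
    ‖star f‖ = ‖f‖ := by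
  rw [Lp.norm_def, Lp.norm_def, eLpNorm_congr_ae (Lp.coeFn_star f), eLpNorm_star]

theorem enorm_integral_smul_le (f : Lp ℂ 2 (volume : Measure (EuclideanSpace ℝ (Fin n))))
    (g : 𝓢(EuclideanSpace ℝ (Fin n), ℂ)) :
    ‖∫ x, g x • f x‖ₑ ≤ ‖f‖ₑ * ‖g.toLp 2‖ₑ := by
  rw [integral_smul_eq_inner, ← ofReal_norm, ← ofReal_norm, ← ofReal_norm,
    ← ENNReal.ofReal_mul (norm_nonneg _)]
  refine ENNReal.ofReal_le_ofReal ?_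
  simpa [norm_Lp_star] using norm_inner_le_norm (𝕜 := ℂ) (star f) (g.toLp 2)

theorem integral_schwartzBessel_smul (b : Fin n → Fin j) (s : Fin j → ℝ)
    (f g : 𝓢(EuclideanSpace ℝ (Fin n), ℂ)) :
    ∫ x, schwartzBessel b s g x • f x = ∫ x, g x • schwartzBessel b s f x := by
  have h := congrArg (fun U : TempDist n ↦ U g)
    (TemperedDistribution.fourierMultiplierCLM_toTemperedDistributionCLM_eq
      (hasTemperateGrowth_symbol b s) f)
  change bessel b s _ g = _ at h
  rw [bessel_apply] at h
  change _ = SchwartzMap.toTemperedDistributionCLM _ _ volume (schwartzBessel b s f) g at h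
  simpa only [SchwartzMap.toTemperedDistributionCLM_apply_apply] using h

/-- The `L²` pairing of Schwartz functions puts the spaces of orders `s` and `-s` in duality. -/
theorem enorm_integral_smul_le_schwartzNorm (b : Fin n → Fin j) (s : Fin j → ℝ)
    (f g : 𝓢(EuclideanSpace ℝ (Fin n), ℂ)) :
    ‖∫ x, g x • f x‖ₑ ≤ schwartzNorm b s f * schwartzNorm b (-s) g := by
  have h := integral_schwartzBessel_smul b (-s) (schwartzBessel b s f) g
  rw [schwartzBessel_neg_schwartzBessel] at h
  have h' : ∫ x, schwartzBessel b (-s) g x • schwartzBessel b s f x =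
      ∫ x, schwartzBessel b (-s) g x • (schwartzBessel b s f).toLp 2 volume x := by
    refine integral_congr_ae ?_
    filter_upwards [(schwartzBessel b s f).coeFn_toLp 2 volume] with x hx
    rw [hx]
  rw [← h, h', schwartzNorm, schwartzNorm]
  exact enorm_integral_smul_le _ _

theorem extend_eq_integral {b : Fin n → Fin j} {s : Fin j → ℝ} {u : Dist n} {U : TempDist n}
    (hU : IsRestrictionOf u U) {f : Lp ℂ 2 (volume : Measure (EuclideanSpace ℝ (Fin n)))}
    (hf : bessel b s U = f) (φ : CTest n) :
    extend u φ = ∫ x, schwartzBessel b (-s) φ.toSchwartz x • f x := by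
  rw [(isRestrictionOf_iff u U).mp hU, ← Lp.toTemperedDistribution_apply, ← hf, bessel_apply,
    schwartzBessel_schwartzBessel_neg]

theorem mem_sobolevSpace_iff (b : Fin n → Fin j) (s : Fin j → ℝ) (u : Dist n) :
    u ∈ sobolevSpace b s ↔ sobolevNorm b s u < ∞ := by
  simp only [sobolevSpace, sobolevNorm, Set.mem_ofPred_eq, iInf_lt_iff, enorm_lt_top, exists_prop,
    and_true]

/-- The Sobolev norm of `u` is the norm of `u` as a functional on the test functions with the norm
of order `-s`. The functional is extended to `L²` by the Hahn–Banach theorem and represented by an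
`L²` function there. -/
theorem sobolevNorm_le_iff (b : Fin n → Fin j) (s : Fin j → ℝ) (u : Dist n) (c : ℝ≥0∞) :
    sobolevNorm b s u ≤ c ↔
      ∀ φ : CTest n, ‖extend u φ‖ₑ ≤ c * schwartzNorm b (-s) φ.toSchwartz := by
  constructor
  · intro h φ
    by_cases h0 : schwartzNorm b (-s) φ.toSchwartz = 0
    · have hφ : φ = 0 := by
        ext x
        simpa using congrArg (fun f : 𝓢(EuclideanSpace ℝ (Fin n), ℂ) ↦ f x)
          (eq_zero_of_schwartzNorm_eq_zero h0)
      simp [hφ]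
    rw [← ENNReal.div_le_iff h0 (schwartzNorm_ne_top b (-s) _)]
    refine le_trans ?_ h
    refine le_iInf fun U ↦ le_iInf fun hU ↦ le_iInf fun f ↦ le_iInf fun hf ↦ ?_
    rw [ENNReal.div_le_iff h0 (schwartzNorm_ne_top b (-s) _), extend_eq_integral hU hf]
    exact enorm_integral_smul_le f _
  · intro h
    rcases eq_or_ne c ∞ with rfl | hc
    · exact le_top
    lift c to ℝ≥0 using hc
    have hnorm (φ : CTest n) : ‖extend u φ‖ ≤ c * ‖(schwartzBessel b (-s) φ.toSchwartz).toLp 2‖ := by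
      have := h φ
      rw [schwartzNorm, ← ofReal_norm, ← ofReal_norm, ← ENNReal.ofReal_coe_nnreal,
        ← ENNReal.ofReal_mul c.coe_nonneg] at this
      exact (ENNReal.ofReal_le_ofReal_iff (by positivity)).mp this
    -- `Λ₀` is the functional `u` on the image `range T` of the test functions in `L²`
    let T : CTest n →ₗ[ℂ] Lp ℂ 2 (volume : Measure (EuclideanSpace ℝ (Fin n))) :=
      { toFun := fun φ ↦ SchwartzMap.toLpCLM ℂ ℂ 2 volume (schwartzBessel b (-s) φ.toSchwartz)
        map_add' := fun φ ψ ↦ by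
          rw [← map_add, ← map_add]
          congr 2
        map_smul' := fun a φ ↦ by
          rw [RingHom.id_apply, ← map_smul, ← map_smul]
          congr 2 }
    have hT : LinearMap.ker T = ⊥ := by
      rw [LinearMap.ker_eq_bot]
      intro φ ψ hφψ
      have h1 := (schwartzBessel_schwartzBessel_neg b s φ.toSchwartz).symm.trans
        ((congrArg _ (SchwartzMap.injective_toLp 2 volume hφψ)).trans
          (schwartzBessel_schwartzBessel_neg b s ψ.toSchwartz))
      ext x
      exact congrArg (fun f : 𝓢(EuclideanSpace ℝ (Fin n), ℂ) ↦ f x) h1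
    obtain ⟨S, hS⟩ := LinearMap.exists_leftInverse_of_injective T hT
    have hS' (φ : CTest n) : S (T φ) = φ := LinearMap.congr_fun hS φ
    let Λ₀ : StrongDual ℂ (LinearMap.range T) :=
      LinearMap.mkContinuous ((extend u ∘ₗ S) ∘ₗ (LinearMap.range T).subtype) c (by
        rintro ⟨_, φ, rfl⟩
        simpa [hS'] using! hnorm φ)
    obtain ⟨Λ, hΛ, hΛn⟩ := exists_extension_norm_eq (LinearMap.range T) Λ₀
    have hΛT (φ : CTest n) : Λ (T φ) = extend u φ := by
      have := hΛ ⟨T φ, φ, rfl⟩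
      simpa [Λ₀, hS'] using this
    have hΛc : ‖Λ‖ ≤ c := hΛn.trans_le (LinearMap.mkContinuous_norm_le _ c.2 _)
    let f : Lp ℂ 2 (volume : Measure (EuclideanSpace ℝ (Fin n))) :=
      -- conjugation, since the pairing of distributions is bilinear and not sesquilinear
      star ((InnerProductSpace.toDual ℂ _).symm Λ)
    have hf (φ : CTest n) : ∫ x, schwartzBessel b (-s) φ.toSchwartz x • f x = extend u φ := by
      rw [integral_smul_eq_inner, star_star, InnerProductSpace.toDual_symm_apply, ← hΛT]
      rfl
    have hfc : ‖f‖ₑ ≤ c := by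
      rw [← ofReal_norm, ← ENNReal.ofReal_coe_nnreal]
      refine ENNReal.ofReal_le_ofReal ?_
      rw [norm_Lp_star, LinearIsometryEquiv.norm_map]
      exact hΛc
    refine le_trans ?_ hfc
    refine iInf_le_of_le (bessel b (-s) (f : TempDist n)) (iInf_le_of_le ?_
      (iInf_le_of_le f (iInf_le_of_le ?_ le_rfl)))
    · rw [isRestrictionOf_iff]
      intro φ
      rw [bessel_apply, Lp.toTemperedDistribution_apply, hf]
    · ext φ
      rw [bessel_apply, bessel_apply, schwartzBessel_neg_schwartzBessel]

open Filter Topology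

/-! ### Translates of test functions -/

/-- The translate `ψ(· - y)` of a real test function. -/
def RTest.translate (y : EuclideanSpace ℝ (Fin n)) (ψ : RTest n) : RTest n where
  toFun x := ψ (x - y)
  contDiff' := ψ.contDiff.comp (contDiff_id.sub contDiff_const)
  hasCompactSupport' := ψ.hasCompactSupport.comp_homeomorph (Homeomorph.subRight y)
  tsupport_subset' := fun _ _ ↦ trivial

/-- Distributions applied to translates of a test function are continuous in the translation: by
uniform continuity of the derivatives, the translates by vectors in a ball depend continuously on
the vector in the space of functions supported in a fixed compact set. -/
theorem continuous_apply_translate (u : Dist n) (ψ : RTest n) :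
    Continuous fun y ↦ u (RTest.translate y ψ) := by
  rw [continuous_iff_continuousAt]
  intro y₀
  obtain ⟨ρ, hρ⟩ := ψ.hasCompactSupport.isCompact.isBounded.subset_closedBall 0
  let K : TopologicalSpace.Compacts (EuclideanSpace ℝ (Fin n)) :=
    ⟨Metric.closedBall y₀ (ρ + 1), isCompact_closedBall y₀ (ρ + 1)⟩
  have hsupp (y : Metric.ball y₀ 1) : Function.support (RTest.translate y.1 ψ) ⊆ K := by
    intro x hx
    have h1 := hρ (subset_tsupport ψ (show x - y.1 ∈ Function.support ψ from hx))
    have h2 := y.2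
    rw [mem_closedBall_zero_iff] at h1
    rw [Metric.mem_ball, dist_eq_norm] at h2
    change x ∈ Metric.closedBall y₀ (ρ + 1)
    rw [Metric.mem_closedBall, dist_eq_norm]
    calc ‖x - y₀‖ = ‖(x - y.1) + (y.1 - y₀)‖ := by congr 1; abel
      _ ≤ ‖x - y.1‖ + ‖y.1 - y₀‖ := norm_add_le _ _
      _ ≤ ρ + 1 := by linarith
  let Y : Metric.ball y₀ 1 → 𝓓_{K}(EuclideanSpace ℝ (Fin n), ℝ) := fun y ↦
    ContDiffMapSupportedIn.of_support_subset (RTest.translate y.1 ψ).contDiff (hsupp y)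
  have hY : Continuous Y := by
    rw [ContDiffMapSupportedIn.continuous_iff_comp]
    intro i
    have huc : UniformContinuous (iteratedFDeriv ℝ i ψ) :=
      (ψ.hasCompactSupport.iteratedFDeriv (𝕜 := ℝ) i).uniformContinuous_of_continuous
        (ψ.contDiff.continuous_iteratedFDeriv (by exact_mod_cast le_top))
    have happ (y : Metric.ball y₀ 1) (x : EuclideanSpace ℝ (Fin n)) :
        ContDiffMapSupportedIn.structureMapCLM ℝ ⊤ i (Y y) x = iteratedFDeriv ℝ i ψ (x - y.1) := by
      rw [ContDiffMapSupportedIn.structureMapCLM_top_apply]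
      exact iteratedFDeriv_comp_sub i y.1 x
    rw [Metric.continuous_iff]
    intro y ε hε
    obtain ⟨δ, hδ, h⟩ := Metric.uniformContinuous_iff.mp huc (ε / 2) (by positivity)
    refine ⟨δ, hδ, fun z hz ↦ ?_⟩
    refine lt_of_le_of_lt ((BoundedContinuousFunction.dist_le (by positivity)).mpr fun x ↦ ?_)
      (half_lt_self hε)
    simp only [Function.comp_apply, happ]
    refine (h ?_).le
    rw [dist_sub_left]
    exact hz
  have hcomp : Continuous fun y : Metric.ball y₀ 1 ↦ u (RTest.translate y.1 ψ) := by
    have hK : (K : Set (EuclideanSpace ℝ (Fin n))) ⊆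
        (⊤ : TopologicalSpace.Opens (EuclideanSpace ℝ (Fin n))) := fun _ _ ↦ trivial
    have hu : Continuous u := u.cont
    exact hu.comp ((TestFunction.continuous_ofSupportedIn hK).comp hY)
  exact (continuousOn_iff_continuous_domRestrict.mpr hcomp).continuousAt
    (Metric.ball_mem_nhds y₀ one_pos)

theorem continuous_extend_translate (u : Dist n) (χ : CTest n) :
    Continuous fun y ↦ extend u (translate y χ) :=
  (continuous_apply_translate u (TestFunction.postcompCLM Complex.reCLM χ)).add
    (continuous_const.mul
      (continuous_apply_translate u (TestFunction.postcompCLM Complex.imCLM χ)))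

theorem CTest.mul_comm (χ φ : CTest n) : χ.mul φ = φ.mul χ := by
  ext x
  simp [_root_.mul_comm]

theorem continuous_extend_distMul_translate (u : Dist n) (χ φ : CTest n) :
    Continuous fun y ↦ extend (distMul u (translate y χ)) φ := by
  have h := continuous_extend_translate (distMul u φ) χ
  simpa only [extend_distMul, CTest.mul_comm φ] using h

/-- The function `y ↦ ‖u τ_y χ‖` is measurable for every distribution `u`: it is lower
semicontinuous, as a supremum of continuous functions. -/
theorem measurable_sobolevNorm_translate (b : Fin n → Fin j) (s : Fin j → ℝ) (u : Dist n)
    (χ : CTest n) : Measurable fun y ↦ sobolevNorm b s (distMul u (translate y χ)) := by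
  refine measurable_of_Iic fun c ↦ IsClosed.measurableSet ?_
  have : (fun y ↦ sobolevNorm b s (distMul u (translate y χ))) ⁻¹' Set.Iic c =
      ⋂ φ : CTest n, {y | ‖extend (distMul u (translate y χ)) φ‖ₑ ≤
        c * schwartzNorm b (-s) φ.toSchwartz} := by
    ext y
    simp [sobolevNorm_le_iff]
  rw [this]
  exact isClosed_iInter fun φ ↦
    isClosed_le (continuous_extend_distMul_translate u χ φ).enorm continuous_const

/-! ### The Sobolev norm controls the Kato norm -/

theorem katoNorm_sq (b : Fin n → Fin j) (s : Fin j → ℝ) (χ : CTest n) (u : Dist n) :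
    katoNorm b s 2 χ u ^ 2 = ∫⁻ y, sobolevNorm b s (distMul u (translate y χ)) ^ 2 := by
  rw [katoNorm, ← ENNReal.rpow_natCast, ← ENNReal.rpow_mul]
  simp

/-- This gives finiteness of `‖u τ_y χ‖` for every `y`, where the integrated estimate gives it for
almost every `y` only. -/
theorem distMul_mem_sobolevSpace {b : Fin n → Fin j} {s : Fin j → ℝ} {u : Dist n}
    (hu : u ∈ sobolevSpace b s) (χ : CTest n) : distMul u χ ∈ sobolevSpace b s := by
  rw [mem_sobolevSpace_iff] at hu ⊢
  obtain ⟨C, hC, h⟩ := exists_schwartzNorm_mul_le b (-s) χ.toSchwartz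
  refine lt_of_le_of_lt ((sobolevNorm_le_iff b s _ (sobolevNorm b s u * C)).mpr fun φ ↦ ?_)
    (ENNReal.mul_lt_top hu hC.lt_top)
  rw [extend_distMul, CTest.mul_comm, mul_assoc]
  refine ((sobolevNorm_le_iff b s u _).mp le_rfl _).trans ?_
  rw [CTest.toSchwartz_mul]
  gcongr
  exact h _

/-- If `u` has the `L²` density `f` after application of `⟨⟨D⟩⟩^s`, approximate `f` by Schwartz
functions: the estimate for Schwartz functions passes to the limit by Fatou's lemma. -/
theorem lintegral_sobolevNorm_translate_le {b : Fin n → Fin j} {s : Fin j → ℝ} {u : Dist n}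
    {U : TempDist n} (hU : IsRestrictionOf u U)
    {f : Lp ℂ 2 (volume : Measure (EuclideanSpace ℝ (Fin n)))} (hf : bessel b s U = f)
    (χ : CTest n) :
    ∫⁻ y, sobolevNorm b s (distMul u (translate y χ)) ^ 2 ≤
      (ENNReal.ofReal (∏ l, 2 ^ |s l / 2|) * schwartzNorm b |s| χ.toSchwartz * ‖f‖ₑ) ^ 2 := by
  obtain ⟨F, hF⟩ : ∃ F : ℕ → 𝓢(EuclideanSpace ℝ (Fin n), ℂ),
      Tendsto (fun k ↦ (F k).toLp 2 volume) atTop (𝓝 f) := by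
    have hd := SchwartzMap.denseRange_toLpCLM (E := EuclideanSpace ℝ (Fin n)) (F := ℂ) (p := 2)
      (by norm_num) (μ := volume)
    obtain ⟨x, hx, hlim⟩ := mem_closure_iff_seq_limit.mp (hd f)
    choose F hF using hx
    exact ⟨F, hlim.congr fun k ↦ (hF k).symm⟩
  set C := ENNReal.ofReal (∏ l, 2 ^ |s l / 2|) * schwartzNorm b |s| χ.toSchwartz
  have hC : C ≠ ∞ := ENNReal.mul_ne_top (by simp) (schwartzNorm_ne_top b |s| _)
  let g (k : ℕ) : 𝓢(EuclideanSpace ℝ (Fin n), ℂ) := schwartzBessel b (-s) (F k)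
  have hg (k : ℕ) : schwartzNorm b s (g k) = ‖(F k).toLp 2 volume‖ₑ := by
    rw [schwartzNorm, schwartzBessel_schwartzBessel_neg]
  have hext (φ : CTest n) :
      Tendsto (fun k ↦ ∫ x, φ.toSchwartz x • g k x) atTop (𝓝 (extend u φ)) := by
    have h (k : ℕ) : ∫ x, φ.toSchwartz x • g k x =
        inner ℂ (star ((schwartzBessel b (-s) φ.toSchwartz).toLp 2 volume)) ((F k).toLp 2 volume) := by
      rw [← integral_schwartzBessel_smul, ← integral_smul_eq_inner]
      refine integral_congr_ae ?_
      filter_upwards [(schwartzBessel b (-s) φ.toSchwartz).coeFn_toLp 2 volume] with x hx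
      rw [hx, smul_eq_mul, smul_eq_mul, mul_comm]
    have h' : extend u φ =
        inner ℂ (star ((schwartzBessel b (-s) φ.toSchwartz).toLp 2 volume)) f := by
      rw [extend_eq_integral hU hf, L2.inner_def]
      refine integral_congr_ae ?_
      filter_upwards [(schwartzBessel b (-s) φ.toSchwartz).coeFn_toLp 2 volume,
        Lp.coeFn_star ((schwartzBessel b (-s) φ.toSchwartz).toLp 2 volume)] with x hx hx'
      rw [hx', Pi.star_apply, hx]
      simp [mul_comm]
    rw [h']
    simp only [h]
    exact tendsto_const_nhds.inner hF
  have hpt (y : EuclideanSpace ℝ (Fin n)) :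
      sobolevNorm b s (distMul u (translate y χ)) ^ 2 ≤ liminf (fun k ↦
        schwartzNorm b s (schwartzMul (g k) (χ.toSchwartz.compSubConstCLM ℂ y)) ^ 2) atTop := by
    set L := liminf (fun k ↦
        schwartzNorm b s (schwartzMul (g k) (χ.toSchwartz.compSubConstCLM ℂ y)) ^ 2) atTop
    have hL : (L ^ (1 / 2 : ℝ)) ^ 2 = L := by
      rw [← ENNReal.rpow_natCast, ← ENNReal.rpow_mul]
      simp
    rw [← hL]
    refine pow_le_pow_left' ((sobolevNorm_le_iff b s _ _).mpr fun φ ↦ ?_) 2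
    refine (ENNReal.pow_right_strictMono two_ne_zero).le_iff_le.mp ?_
    rw [mul_pow, hL, extend_distMul]
    have hlim := ((ENNReal.continuous_pow 2).tendsto _).comp (hext ((translate y χ).mul φ)).enorm
    rw [← hlim.liminf_eq, mul_comm, ← ENNReal.liminf_const_mul_of_ne_top
      (ENNReal.pow_ne_top (schwartzNorm_ne_top b (-s) _))]
    refine liminf_le_liminf (.of_forall fun k ↦ ?_)
    simp only [Function.comp_apply]
    rw [← mul_pow]
    refine pow_le_pow_left' ?_ 2
    have h := enorm_integral_smul_le_schwartzNorm b s
      (schwartzMul (g k) (χ.toSchwartz.compSubConstCLM ℂ y)) φ.toSchwartz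
    rw [mul_comm] at h
    refine le_of_eq_of_le ?_ h
    congr 2 with x
    simp
    ring
  calc _ ≤ ∫⁻ y, liminf (fun k ↦
        schwartzNorm b s (schwartzMul (g k) (χ.toSchwartz.compSubConstCLM ℂ y)) ^ 2) atTop :=
        lintegral_mono hpt
    _ ≤ liminf (fun k ↦ ∫⁻ y,
        schwartzNorm b s (schwartzMul (g k) (χ.toSchwartz.compSubConstCLM ℂ y)) ^ 2) atTop :=
        lintegral_liminf_le fun k ↦ measurable_schwartzNorm_translate b s _ _
    _ ≤ liminf (fun k ↦ (C * ‖(F k).toLp 2 volume‖ₑ) ^ 2) atTop := by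
        refine liminf_le_liminf (.of_forall fun k ↦ ?_)
        rw [← hg]
        exact lintegral_schwartzNorm_translate_le b s _ _
    _ = _ := by
        refine Tendsto.liminf_eq ?_
        exact ((ENNReal.continuous_pow 2).tendsto _).comp
          (ENNReal.Tendsto.const_mul hF.enorm (Or.inr hC))

theorem katoNorm_le_mul_sobolevNorm (b : Fin n → Fin j) (s : Fin j → ℝ) (χ : CTest n) :
    ∃ C : ℝ≥0∞, C ≠ ∞ ∧ ∀ u : Dist n, katoNorm b s 2 χ u ≤ C * sobolevNorm b s u := by
  set C := ENNReal.ofReal (∏ l, 2 ^ |s l / 2|) * schwartzNorm b |s| χ.toSchwartz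
  have hC : C ≠ ∞ := ENNReal.mul_ne_top (by simp) (schwartzNorm_ne_top b |s| _)
  -- the constant is made nonzero, so that one can divide by it below the infimum
  refine ⟨C + 1, by finiteness, fun u ↦ ?_⟩
  rw [mul_comm, ← ENNReal.div_le_iff (by simp) (by finiteness)]
  refine le_iInf fun U ↦ le_iInf fun hU ↦ le_iInf fun f ↦ le_iInf fun hf ↦ ?_
  rw [ENNReal.div_le_iff (by simp) (by finiteness), mul_comm]
  refine (ENNReal.pow_right_strictMono two_ne_zero).le_iff_le.mp ?_
  rw [katoNorm_sq]
  refine (lintegral_sobolevNorm_translate_le hU hf χ).trans ?_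
  gcongr
  exact le_self_add

/-! ### A dual window -/

theorem finite_setOf_lattice_norm_le (β : Module.Basis (Fin n) ℝ (EuclideanSpace ℝ (Fin n)))
    (R : ℝ) : {k : Submodule.span ℤ (Set.range β) | ‖(k : EuclideanSpace ℝ (Fin n))‖ ≤ R}.Finite := by
  have h := (ZSpan.setFinite_inter β
    (Metric.isBounded_closedBall (x := (0 : EuclideanSpace ℝ (Fin n))) (r := R))).preimage
    (f := ((↑) : Submodule.span ℤ (Set.range β) → EuclideanSpace ℝ (Fin n)))
    Subtype.val_injective.injOn
  refine h.subset fun k hk ↦ ⟨?_, k.2⟩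
  simpa using hk

theorem exists_bound_of_ne_zero (χ : CTest n) : ∃ R : ℝ, ∀ x, χ x ≠ 0 → ‖x‖ ≤ R := by
  obtain ⟨R, hR⟩ := χ.hasCompactSupport.isCompact.isBounded.subset_closedBall 0
  exact ⟨R, fun x hx ↦ by simpa using hR (subset_tsupport χ hx)⟩

/-- A nonzero window `χ` has a dual window `χ'` for some lattice: the translates of `χ χ'` by the
lattice form a partition of unity. With a fine enough lattice, `G = ∑ₖ |χ(· - k)|²` is positive, and
`χ' = χ̄ / G`. The sum is written over arbitrary finite sets containing all nonzero terms. -/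
theorem exists_dual_window {χ : CTest n} (hχ : χ ≠ 0) :
    ∃ (β : Module.Basis (Fin n) ℝ (EuclideanSpace ℝ (Fin n))) (χ' : CTest n), ∀ x,
      ∀ T : Finset (Submodule.span ℤ (Set.range β)),
        (∀ k : Submodule.span ℤ (Set.range β), χ (x - k) ≠ 0 → k ∈ T) →
        ∑ k ∈ T, χ (x - k) * χ' (x - k) = 1 := by
  obtain ⟨x₀, hx₀⟩ : ∃ x, χ x ≠ 0 := by
    by_contra! h
    exact hχ (by ext x; simpa using h x)
  obtain ⟨r, hr, hball⟩ := Metric.eventually_nhds_iff.mp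
    (χ.continuous.continuousAt.eventually_ne hx₀)
  obtain ⟨R, hR⟩ := exists_bound_of_ne_zero χ
  have hn : (0 : ℝ) < n + 1 := by positivity
  have hε : 0 < r / (n + 1) := by positivity
  -- the mesh is such that every point is within `r` of the lattice
  let β : Module.Basis (Fin n) ℝ (EuclideanSpace ℝ (Fin n)) :=
    (EuclideanSpace.basisFun (Fin n) ℝ).toBasis.unitsSMul fun _ ↦ Units.mk0 _ hε.ne'
  have hβ : ∑ i, ‖β i‖ < r := by
    have (i : Fin n) : ‖β i‖ = r / (n + 1) := by
      simp [β, Module.Basis.unitsSMul_apply, Units.smul_def, norm_smul, abs_of_pos hr, abs_of_pos hn]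
    simp only [this, Finset.sum_const, Finset.card_univ, Fintype.card_fin, nsmul_eq_mul]
    rw [mul_div_assoc', div_lt_iff₀ hn]
    nlinarith
  let L := Submodule.span ℤ (Set.range β)
  let G (x : EuclideanSpace ℝ (Fin n)) : ℝ := ∑ᶠ k : L, ‖χ (x - k)‖ ^ 2
  have hG_eq (x : EuclideanSpace ℝ (Fin n)) (T : Finset L) (hT : ∀ k : L, χ (x - k) ≠ 0 → k ∈ T) :
      G x = ∑ k ∈ T, ‖χ (x - k)‖ ^ 2 :=
    finsum_eq_sum_of_support_subset _ fun k hk ↦ hT k fun h ↦ hk (by simp [h])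
  have hfin (x : EuclideanSpace ℝ (Fin n)) : ∃ T : Finset L, ∀ k : L, χ (x - k) ≠ 0 → k ∈ T := by
    refine ⟨(finite_setOf_lattice_norm_le β (‖x‖ + R)).toFinset, fun k hk ↦ ?_⟩
    rw [Set.Finite.mem_toFinset]
    have h1 := hR _ hk
    calc ‖(k : EuclideanSpace ℝ (Fin n))‖ = ‖x - (x - k)‖ := by congr 1; abel
      _ ≤ ‖x‖ + ‖x - k‖ := norm_sub_le _ _
      _ ≤ ‖x‖ + R := by gcongr
  have hG_pos (x : EuclideanSpace ℝ (Fin n)) : 0 < G x := by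
    obtain ⟨T, hT⟩ := hfin x
    rw [hG_eq x T hT]
    have hk : χ (x - ZSpan.floor β (x - x₀)) ≠ 0 := by
      refine hball ?_
      rw [dist_eq_norm]
      calc ‖x - (ZSpan.floor β (x - x₀) : EuclideanSpace ℝ (Fin n)) - x₀‖
          = ‖ZSpan.fract β (x - x₀)‖ := by rw [ZSpan.fract_apply]; congr 1; abel
        _ ≤ _ := ZSpan.norm_fract_le β _
        _ < r := hβ
    exact Finset.sum_pos' (fun _ _ ↦ by positivity) ⟨_, hT _ hk, by positivity⟩
  have hG_periodic (x : EuclideanSpace ℝ (Fin n)) (k : L) : G (x - k) = G x := by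
    have h := finsum_comp_equiv (Equiv.addLeft k) (f := fun l : L ↦ ‖χ (x - l)‖ ^ 2)
    rw [← show _ = G x from h]
    refine finsum_congr fun l ↦ ?_
    simp [sub_sub]
  have hG_smooth : ContDiff ℝ ((⊤ : ℕ∞) : WithTop ℕ∞) G := by
    rw [← contMDiff_iff_contDiff]
    refine contMDiff_finsum (fun k ↦ ?_) fun x ↦ ?_
    · rw [contMDiff_iff_contDiff]
      exact (χ.contDiff.comp (contDiff_id.sub contDiff_const)).norm_sq ℝ
    · refine ⟨Metric.ball x 1, Metric.ball_mem_nhds x one_pos,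
        (finite_setOf_lattice_norm_le β (‖x‖ + 1 + R)).subset ?_⟩
      rintro k ⟨z, hz, hzx⟩
      have h1 := hR (z - k) fun h ↦ hz (by simp [h])
      rw [Metric.mem_ball, dist_eq_norm] at hzx
      have h2 := norm_sub_le z (z - k)
      have h3 := norm_add_le x (z - x)
      rw [sub_sub_cancel] at h2
      rw [add_sub_cancel] at h3
      change ‖(k : EuclideanSpace ℝ (Fin n))‖ ≤ _
      linarith
  let χ' : CTest n :=
    { toFun := fun x ↦ (starRingEnd ℂ) (χ x) * ((G x)⁻¹ : ℝ)
      contDiff' := (Complex.conjCLE.contDiff.comp χ.contDiff).mul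
        (Complex.ofRealCLM.contDiff.comp (hG_smooth.inv fun x ↦ (hG_pos x).ne'))
      hasCompactSupport' := (χ.hasCompactSupport.comp_left (map_zero _)).mul_right
      tsupport_subset' := fun _ _ ↦ trivial }
  refine ⟨β, χ', fun x T hT ↦ ?_⟩
  have hterm (k : L) : χ (x - k) * χ' (x - k) = ((‖χ (x - k)‖ ^ 2 * (G x)⁻¹ : ℝ) : ℂ) := by
    change χ (x - k) * ((starRingEnd ℂ) (χ (x - k)) * ((G (x - k))⁻¹ : ℝ)) = _
    rw [hG_periodic, ← mul_assoc, Complex.mul_conj, Complex.normSq_eq_norm_sq]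
    push_cast
    rfl
  rw [Finset.sum_congr rfl fun k _ ↦ hterm k, ← Complex.ofReal_sum, ← Finset.sum_mul, ← hG_eq x T hT,
    mul_inv_cancel₀ (hG_pos x).ne', Complex.ofReal_one]

/-! ### The Kato norm controls the Sobolev norm -/

/-- The expansion `⟨u, φ⟩ = ∑ₖ ⟨u τ_{k+y} χ, φ τ_{k+y} χ'⟩`, estimated term by term. -/
theorem enorm_extend_le_tsum {b : Fin n → Fin j} {s : Fin j → ℝ}
    {β : Module.Basis (Fin n) ℝ (EuclideanSpace ℝ (Fin n))} {χ χ' : CTest n}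
    (h : ∀ x, ∀ T : Finset (Submodule.span ℤ (Set.range β)),
        (∀ k : Submodule.span ℤ (Set.range β), χ (x - k) ≠ 0 → k ∈ T) →
        ∑ k ∈ T, χ (x - k) * χ' (x - k) = 1)
    (u : Dist n) (φ : CTest n) (y : EuclideanSpace ℝ (Fin n)) :
    ‖extend u φ‖ₑ ≤ ∑' k : Submodule.span ℤ (Set.range β),
      sobolevNorm b s (distMul u (translate (↑k + y) χ)) *
        schwartzNorm b (-s) (φ.mul (translate (↑k + y) χ')).toSchwartz := by
  obtain ⟨R, hR⟩ := exists_bound_of_ne_zero χ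
  obtain ⟨R', hR'⟩ := exists_bound_of_ne_zero φ
  let T := (finite_setOf_lattice_norm_le β (R' + ‖y‖ + R)).toFinset
  have hT (x : EuclideanSpace ℝ (Fin n)) (hx : φ x ≠ 0) (k : Submodule.span ℤ (Set.range β))
      (hk : χ (x - y - k) ≠ 0) : k ∈ T := by
    rw [Set.Finite.mem_toFinset]
    calc ‖(k : EuclideanSpace ℝ (Fin n))‖ = ‖x - y - (x - y - k)‖ := by congr 1; abel
      _ ≤ ‖x‖ + ‖y‖ + ‖x - y - k‖ := (norm_sub_le _ _).trans (by gcongr; exact norm_sub_le _ _)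
      _ ≤ R' + ‖y‖ + R := by
        gcongr
        · exact hR' x hx
        · exact hR _ hk
  let ψ (k : Submodule.span ℤ (Set.range β)) : CTest n :=
    (translate ((k : EuclideanSpace ℝ (Fin n)) + y) χ).mul (φ.mul (translate (k + y) χ'))
  have hφ : φ = ∑ k ∈ T, ψ k := by
    ext x
    have hsum : (∑ k ∈ T, ψ k) x =
        ∑ k ∈ T, φ x * (χ (x - y - k) * χ' (x - y - k)) := by
      rw [sum_apply]
      refine Finset.sum_congr rfl fun k _ ↦ ?_
      simp only [ψ, CTest.mul_apply, translate_apply, sub_add_eq_sub_sub, sub_right_comm x _ y]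
      ring
    rw [hsum, ← Finset.mul_sum]
    by_cases hx : φ x = 0
    · simp [hx]
    · rw [h (x - y) T (hT x hx), mul_one]
  have hψ (k : Submodule.span ℤ (Set.range β)) : ‖extend u (ψ k)‖ₑ ≤
      sobolevNorm b s (distMul u (translate (k + y) χ)) *
        schwartzNorm b (-s) (φ.mul (translate (k + y) χ')).toSchwartz := by
    rw [← extend_distMul]
    exact (sobolevNorm_le_iff b s _ _).mp le_rfl _
  calc ‖extend u φ‖ₑ = ‖∑ k ∈ T, extend u (ψ k)‖ₑ := by rw [← map_sum, ← hφ]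
    _ ≤ ∑ k ∈ T, ‖extend u (ψ k)‖ₑ := enorm_sum_le _ _
    _ ≤ ∑ k ∈ T, _ := Finset.sum_le_sum fun k _ ↦ hψ k
    _ ≤ _ := ENNReal.sum_le_tsum T

theorem sobolevNorm_le_mul_katoNorm (b : Fin n → Fin j) (s : Fin j → ℝ) {χ : CTest n}
    (hχ : χ ≠ 0) :
    ∃ C : ℝ≥0∞, C ≠ ∞ ∧ ∀ u : Dist n, sobolevNorm b s u ≤ C * katoNorm b s 2 χ u := by
  obtain ⟨β, χ', h⟩ := exists_dual_window hχ
  set C := ENNReal.ofReal (∏ l, 2 ^ |(-s) l / 2|) * schwartzNorm b |(-s)| χ'.toSchwartz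
  have hC : C ≠ ∞ := ENNReal.mul_ne_top (by simp) (schwartzNorm_ne_top b _ _)
  have hdom := ZSpan.isAddFundamentalDomain' β (volume : Measure (EuclideanSpace ℝ (Fin n)))
  have : Countable (Submodule.span ℤ (Set.range β)).toAddSubgroup :=
    inferInstanceAs (Countable (Submodule.span ℤ (Set.range β)))
  set V := volume (ZSpan.fundamentalDomain β)
  have hV0 : V ≠ 0 := ZSpan.measure_fundamentalDomain_ne_zero β
  have hVt : V ≠ ∞ := (ZSpan.fundamentalDomain_isBounded β).measure_lt_top.ne
  refine ⟨C / V, ENNReal.div_ne_top hC hV0, fun u ↦ (sobolevNorm_le_iff b s u _).mpr fun φ ↦ ?_⟩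
  set a : EuclideanSpace ℝ (Fin n) → ℝ≥0∞ := fun y ↦ sobolevNorm b s (distMul u (translate y χ))
  set d : EuclideanSpace ℝ (Fin n) → ℝ≥0∞ := fun y ↦
    schwartzNorm b (-s) (φ.mul (translate y χ')).toSchwartz
  have ha : Measurable a := measurable_sobolevNorm_translate b s u χ
  have hd_eq : d = fun y ↦
      schwartzNorm b (-s) (schwartzMul φ.toSchwartz (χ'.toSchwartz.compSubConstCLM ℂ y)) := by
    ext y
    simp only [d, CTest.toSchwartz_mul, CTest.toSchwartz_translate]
  have hd : Measurable d := by
    have h2 := (measurable_schwartzNorm_translate b (-s) φ.toSchwartz χ'.toSchwartz).pow_const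
      (1 / 2 : ℝ)
    rw [hd_eq]
    refine (congrArg Measurable (funext fun y ↦ ?_)).mp h2
    rw [← ENNReal.rpow_natCast, ← ENNReal.rpow_mul]
    simp
  have hprod : V * ‖extend u φ‖ₑ ≤ ∫⁻ y, a y * d y := by
    calc V * ‖extend u φ‖ₑ = ∫⁻ _ in ZSpan.fundamentalDomain β, ‖extend u φ‖ₑ := by
          rw [setLIntegral_const, mul_comm]
      _ ≤ ∫⁻ y in ZSpan.fundamentalDomain β,
            ∑' k : Submodule.span ℤ (Set.range β), a (k + y) * d (k + y) :=
          lintegral_mono fun y ↦ enorm_extend_le_tsum h u φ y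
      _ = ∑' k : Submodule.span ℤ (Set.range β),
            ∫⁻ y in ZSpan.fundamentalDomain β, a (k + y) * d (k + y) :=
          lintegral_tsum fun k ↦ by fun_prop
      _ = ∫⁻ y, a y * d y := (hdom.lintegral_eq_tsum'' fun y ↦ a y * d y).symm
  have hsq : V * ‖extend u φ‖ₑ ≤
      katoNorm b s 2 χ u * (C * schwartzNorm b (-s) φ.toSchwartz) := by
    refine (ENNReal.pow_right_strictMono two_ne_zero).le_iff_le.mp ?_
    calc (V * ‖extend u φ‖ₑ) ^ 2 ≤ (∫⁻ y, a y * d y) ^ 2 := pow_le_pow_left' hprod 2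
      _ ≤ (∫⁻ y, a y ^ 2) * ∫⁻ y, d y ^ 2 :=
          sq_lintegral_mul_le _ ha.aemeasurable hd.aemeasurable
      _ ≤ katoNorm b s 2 χ u ^ 2 * (C * schwartzNorm b (-s) φ.toSchwartz) ^ 2 := by
          rw [katoNorm_sq, hd_eq]
          gcongr
          exact lintegral_schwartzNorm_translate_le b (-s) _ _
      _ = _ := (mul_pow _ _ _).symm
  calc ‖extend u φ‖ₑ ≤ katoNorm b s 2 χ u * (C * schwartzNorm b (-s) φ.toSchwartz) / V := by
        rwa [ENNReal.le_div_iff_mul_le (Or.inl hV0) (Or.inl hVt), mul_comm]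
    _ = _ := by
        simp only [div_eq_mul_inv]
        ring

theorem exists_cTest_ne_zero (n : ℕ) : ∃ χ : CTest n, χ ≠ 0 := by
  let f : ContDiffBump (0 : EuclideanSpace ℝ (Fin n)) := ⟨1, 2, one_pos, one_lt_two⟩
  let χ : RTest n := ⟨f, f.contDiff, f.hasCompactSupport, fun _ _ ↦ trivial⟩
  refine ⟨χ.toComplex, fun h ↦ ?_⟩
  have h0 := congrArg (fun φ : CTest n ↦ φ 0) h
  have h1 : f 0 = 1 := f.one_of_mem_closedBall (by simp [f])
  have h2 : χ.toComplex 0 = (f 0 : ℂ) := rfl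
  simp [h2, h1] at h0

end KatoSobolev

end

open KatoSobolev in
theorem theorem3p10 (n j : ℕ) (b : Fin n → Fin j) (hb : Function.Surjective b)
    (s : Fin j → ℝ) :
    sobolevSpace b s = katoSobolevSpace b s 2 ∧
      ∀ χ : CTest n, χ ≠ 0 → ∃ C : ℝ≥0, 1 ≤ C ∧ ∀ u : Dist n,
        sobolevNorm b s u ≤ C * katoNorm b s 2 χ u ∧
        katoNorm b s 2 χ u ≤ C * sobolevNorm b s u := by
  have equiv (χ : CTest n) (hχ : χ ≠ 0) : ∃ C : ℝ≥0, 1 ≤ C ∧ ∀ u : Dist n,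
      sobolevNorm b s u ≤ C * katoNorm b s 2 χ u ∧
      katoNorm b s 2 χ u ≤ C * sobolevNorm b s u := by
    obtain ⟨C₁, hC₁, h₁⟩ := sobolevNorm_le_mul_katoNorm b s hχ
    obtain ⟨C₂, hC₂, h₂⟩ := katoNorm_le_mul_sobolevNorm b s χ
    lift C₁ to ℝ≥0 using hC₁
    lift C₂ to ℝ≥0 using hC₂
    refine ⟨max 1 (max C₁ C₂), le_max_left _ _, fun u ↦ ⟨(h₁ u).trans ?_, (h₂ u).trans ?_⟩⟩
    · gcongr
      exact (le_max_left _ _).trans (le_max_right _ _)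
    · gcongr
      exact (le_max_right _ _).trans (le_max_right _ _)
  refine ⟨Set.ext fun u ↦ ⟨fun hu ↦ ?_, ?_⟩, equiv⟩
  · obtain ⟨χ, hχ⟩ := exists_cTest_ne_zero n
    obtain ⟨C, -, h⟩ := equiv χ hχ
    exact ⟨χ, hχ, fun y ↦ distMul_mem_sobolevSpace hu _,
      (measurable_sobolevNorm_translate b s u χ).aemeasurable,
      (h u).2.trans_lt (ENNReal.mul_lt_top ENNReal.coe_lt_top ((mem_sobolevSpace_iff b s u).mp hu))⟩
  · rintro ⟨χ, hχ, -, -, hu⟩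
    obtain ⟨C, -, h⟩ := equiv χ hχ
    exact (mem_sobolevSpace_iff b s u).mpr
      ((h u).1.trans_lt (ENNReal.mul_lt_top ENNReal.coe_lt_top hu))
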